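/- Let $k$ be an algebraically closed field, $\mathbb T$ an algebraic torus over $k$ with character lattice $M$, and put $N_{\mathbb Q}=\operatorname{Hom}(M,\mathbb Q)$. Let $X\subset\mathbb T$ be an irreducible closed subvariety, with coordinate ring $k[X]$ and function field $k(X)$. Let $K=\bigcup_{n\ge 1}k((\varepsilon^{1/n}))$ be the field of Puiseux series over $k$, with $\mathbf{ord}:K\to\mathbb Q\cup\{\infty\}$ the lowest exponent, and let $K[X]=k[X]\otimes_k K$. A ring valuation of $K[X]$ is a map $K[X]\to\mathbb Q\cup\{\infty\}$ of the form $v\circ f$, where $f:K[X]\to L$ is a ring homomorphism to a field and $v:L\to\mathbb Q\cup\{\infty\}$ is a valuation of $L$. For a ring valuation $v$ of $K[X]$, or a valuation $v$ of $k(X)$ with values in $\mathbb Q\cup\{\infty\}$, let $[v]\in N_{\mathbb Q}$ be given by $[v](m)=v(m|_X)$ for $m\in M$. The tropical variety of $X$ is $$\mathcal T(X)=\{[\mathbf{val}] \mid \mathbf{val}\text{ a ring valuation of }K[X]\text{ with }\mathbf{val}|_K=\mathbf{ord}\}\subset N_{\mathbb Q}.$$ Let $\mathcal W(X)$ be the set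 of divisorial discrete valuations of $k(X)$, i.e. the valuations $c\cdot\operatorname{val}_D$, where $c\in\mathbb Q_{>0}$ and $\operatorname{val}_D$ is the order of vanishing along an irreducible divisor $D$ on a normal variety over $k$ whose function field is identified with $k(X)$ over $k$. Let $\mathcal D(X)$ be the set of discrete valuations of $k(X)$ trivial on $k$, i.e. the valuations $v:k(X)\to\mathbb Q\cup\{\infty\}$ with $v|_{k^*}=0$ and $v(k(X)^*)=\mathbb Z c$ for some $c\in\mathbb Q_{>0}$. Let $0$ denote the trivial valuation of $k(X)$ (the case $c=0$). **Theorem.** One has $$\mathcal T(X)=\{[v]\mid v\in\mathcal W(X)\cup\{0\}\}=\{[v]\mid v\in\mathcal D(X)\cup\{0\}\}.$$ Moreover, if $\dim X\ge 1$, then the trivial valuation is not needed: $$\mathcal T(X)=\{[v]\mid v\in\mathcal W(X)\}=\{[v]\mid v\in\mathcal D(X)\}.$$ -/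

import Mathlib

universe u

noncomputable section

namespace GeometricTropicalization

open AlgebraicGeometry CategoryTheory TensorProduct

/-! ### Puiseux series -/

/-- The map `z ↦ z / n` on exponents. -/
def divHom (n : ℕ) : ℤ →+ ℚ where
  toFun z := (z : ℚ) / n
  map_zero' := by simp
  map_add' a b := by push_cast; ring

lemma divHom_le_iff {n : ℕ} (hn : 0 < n) (a b : ℤ) : divHom n a ≤ divHom n b ↔ a ≤ b := by
  have hn' : (0 : ℚ) < n := by exact_mod_cast hn
  change (a : ℚ) / n ≤ (b : ℚ) / n ↔ a ≤ b
  rw [div_le_div_iff_of_pos_right hn', Int.cast_le]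

lemma divHom_injective {n : ℕ} (hn : 0 < n) : Function.Injective (divHom n) := fun a b h =>
  le_antisymm ((divHom_le_iff hn a b).1 h.le) ((divHom_le_iff hn b a).1 h.ge)

/-- The inclusion `k((s)) → k((ε^ℚ))`, `s ↦ ε^(1/n)`, of Laurent series into Hahn series with
rational exponents. -/
def laurentToHahn (k : Type u) [Field k] (n : ℕ) (hn : 0 < n) :
    HahnSeries ℤ k →+* HahnSeries ℚ k :=
  HahnSeries.embDomainRingHom (divHom n) (divHom_injective hn) (divHom_le_iff hn)

lemma laurentToHahn_coeff (k : Type u) [Field k] {n : ℕ} (hn : 0 < n) (f : HahnSeries ℤ k)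
    (z : ℤ) : (laurentToHahn k n hn f).coeff (divHom n z) = f.coeff z :=
  HahnSeries.embDomain_coeff (f := ⟨⟨divHom n, divHom_injective hn⟩, divHom_le_iff hn _ _⟩)

lemma laurentToHahn_coeff_of_notMem (k : Type u) [Field k] {n : ℕ} (hn : 0 < n)
    (f : HahnSeries ℤ k) {q : ℚ} (hq : q ∉ Set.range (divHom n)) :
    (laurentToHahn k n hn f).coeff q = 0 :=
  HahnSeries.embDomain_of_notMem_range
    (f := ⟨⟨divHom n, divHom_injective hn⟩, divHom_le_iff hn _ _⟩) hq

lemma laurentToHahn_range_le (k : Type u) [Field k] (n m : ℕ) (hn : 0 < n) (hm : 0 < m) :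
    (laurentToHahn k n hn).fieldRange ≤
      (laurentToHahn k (n * m) (Nat.mul_pos hn hm)).fieldRange := by
  rintro _ ⟨f, rfl⟩
  have hm' : (0 : ℤ) < m := by exact_mod_cast hm
  let e : ℤ ↪o ℤ := OrderEmbedding.ofStrictMono (fun z : ℤ => z * m)
    fun a b h => mul_lt_mul_of_pos_right h hm'
  have key : ∀ z : ℤ, divHom (n * m) (e z) = divHom n z := by
    intro z
    have hn0 : (n : ℚ) ≠ 0 := by positivity
    have hm0 : (m : ℚ) ≠ 0 := by positivity
    change ((z * m : ℤ) : ℚ) / ((n * m : ℕ) : ℚ) = (z : ℚ) / n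
    push_cast
    field_simp
  refine ⟨HahnSeries.embDomain e f, ?_⟩
  ext q
  change (laurentToHahn k (n * m) _ (HahnSeries.embDomain e f)).coeff q =
    (laurentToHahn k n hn f).coeff q
  by_cases hq : q ∈ Set.range (divHom n)
  · obtain ⟨z, rfl⟩ := hq
    rw [laurentToHahn_coeff, ← key z, laurentToHahn_coeff, HahnSeries.embDomain_coeff]
  · rw [laurentToHahn_coeff_of_notMem k hn f hq]
    by_cases hq' : q ∈ Set.range (divHom (n * m))
    · obtain ⟨z, rfl⟩ := hq'
      rw [laurentToHahn_coeff]
      refine HahnSeries.embDomain_of_notMem_range ?_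
      rintro ⟨y, rfl⟩
      exact hq ⟨y, (key y).symm⟩
    · exact laurentToHahn_coeff_of_notMem k _ _ hq'

/-- The field of Puiseux series `K = ⋃ₙ k((ε^(1/n)))`. -/
def Puiseux (k : Type u) [Field k] : Subfield (HahnSeries ℚ k) where
  carrier := {f | ∃ (n : ℕ) (hn : 0 < n), f ∈ (laurentToHahn k n hn).fieldRange}
  zero_mem' := ⟨1, one_pos, zero_mem _⟩
  one_mem' := ⟨1, one_pos, one_mem _⟩
  neg_mem' := by
    rintro f ⟨n, hn, hf⟩
    exact ⟨n, hn, neg_mem hf⟩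
  add_mem' := by
    rintro f g ⟨n, hn, hf⟩ ⟨m, hm, hg⟩
    refine ⟨n * m, Nat.mul_pos hn hm, add_mem (laurentToHahn_range_le k n m hn hm hf) ?_⟩
    have := laurentToHahn_range_le k m n hm hn hg
    simpa only [mul_comm m n] using this
  mul_mem' := by
    rintro f g ⟨n, hn, hf⟩ ⟨m, hm, hg⟩
    refine ⟨n * m, Nat.mul_pos hn hm, mul_mem (laurentToHahn_range_le k n m hn hm hf) ?_⟩
    have := laurentToHahn_range_le k m n hm hn hg
    simpa only [mul_comm m n] using this
  inv_mem' := by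
    rintro f ⟨n, hn, hf⟩
    exact ⟨n, hn, inv_mem hf⟩

lemma C_mem_puiseux (k : Type u) [Field k] (a : k) :
    (HahnSeries.C a : HahnSeries ℚ k) ∈ Puiseux k :=
  ⟨1, one_pos, HahnSeries.C a, HahnSeries.embDomainRingHom_C⟩

/-- `K` is an extension of `k`, by the constant series. -/
instance (k : Type u) [Field k] : Algebra k (Puiseux k) :=
  ((HahnSeries.C : k →+* HahnSeries ℚ k).codRestrict (Puiseux k) (C_mem_puiseux k)).toAlgebra

/-- The valuation `ord : K → ℚ ∪ {∞}`, the lowest exponent of a Puiseux series. -/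
def puiseuxOrd (k : Type u) [Field k] : AddValuation (Puiseux k) (WithTop ℚ) :=
  (HahnSeries.addVal ℚ k).comap (Puiseux k).subtype

/-! ### Points of `N_ℚ` defined by valuations -/

/-- A ring valuation with values in `ℚ ∪ {∞}`: one of the form `v ∘ f`, where `f` is a
homomorphism to a field `L` and `v` is a valuation of `L`. -/
def IsRingValuation {R : Type u} [Ring R] (val : AddValuation R (WithTop ℚ)) : Prop :=
  ∃ (L : Type u) (_ : Field L) (f : R →+* L) (v : AddValuation L (WithTop ℚ)), val = v.comap f

lemma val_ne_top_of_isUnit {R : Type*} [Ring R] (v : AddValuation R (WithTop ℚ)) {x : R}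
    (hx : IsUnit x) : v x ≠ ⊤ := by
  obtain ⟨y, hy⟩ := hx.exists_right_inv
  intro h
  have h1 : v (x * y) = 0 := by rw [hy, v.map_one]
  rw [v.map_mul, h, top_add] at h1
  exact WithTop.top_ne_zero h1

/-- The element `[v] : m ↦ v(χ m)` of `N_ℚ = Hom(M, ℚ)`, where `χ` realizes the characters in `M`
as elements of `R`. The value `v(χ m)` is finite because `χ m` is a unit of `R`. -/
def bracket {M : Type*} [AddCommGroup M] {R : Type*} [Ring R] (χ : Multiplicative M →* R)
    (v : AddValuation R (WithTop ℚ)) : M →+ ℚ where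
  toFun m := (v (χ (Multiplicative.ofAdd m))).untop
    (val_ne_top_of_isUnit v ((Group.isUnit _).map χ))
  map_zero' := by
    rw [← WithTop.coe_inj, WithTop.coe_untop]; simp
  map_add' a b := by
    rw [← WithTop.coe_inj, WithTop.coe_add]
    simp only [WithTop.coe_untop]
    rw [ofAdd_add, map_mul, v.map_mul]

/-! ### The tropical variety of `X`

The torus `𝕋` has character lattice `M`, so `k[𝕋]` is the group algebra `k[M]`, and the irreducible
closed subvariety `X ⊂ 𝕋` is given by its ideal, a prime ideal `I` of `k[M]`. -/

section Variety

variable {k : Type u} [Field k] {M : Type u} [AddCommGroup M] (I : Ideal (AddMonoidAlgebra k M))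

/-- The coordinate ring `k[X]`. -/
abbrev CoordRing : Type u := AddMonoidAlgebra k M ⧸ I

/-- Restriction of characters to `X`, as functions in `k[X]`. -/
def charOn : Multiplicative M →* CoordRing I :=
  ((Ideal.Quotient.mk I : AddMonoidAlgebra k M →+* CoordRing I) : _ →* _).comp
    (AddMonoidAlgebra.of k M)

/-- The ring `K[X] = k[X] ⊗ₖ K`, for `K` the field of Puiseux series. -/
abbrev PuiseuxCoordRing : Type u := CoordRing I ⊗[k] Puiseux k

/-- Characters as elements of `K[X]`. -/
def charPuiseux : Multiplicative M →* PuiseuxCoordRing I :=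
  ((Algebra.TensorProduct.includeLeft :
    CoordRing I →ₐ[k] PuiseuxCoordRing I) : _ →* _).comp (charOn I)

/-- The set `𝒱(X)` of ring valuations of `K[X]` that restrict to `ord` on `K`. -/
def puiseuxValuations : Set (AddValuation (PuiseuxCoordRing I) (WithTop ℚ)) :=
  {val | IsRingValuation val ∧
    ∀ a : Puiseux k, val (Algebra.TensorProduct.includeRight a) = puiseuxOrd k a}

/-- The tropical variety `𝒯(X) ⊂ N_ℚ`. -/
def tropicalVariety : Set (M →+ ℚ) :=
  bracket (charPuiseux I) '' puiseuxValuations I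

end Variety

/-! ### Valuations of the function field -/

/-- A normal variety over `k`: an integral normal scheme, separated and of finite type over `k`. -/
structure NormalVariety (k : Type u) [Field k] where
  Y : Scheme.{u}
  toSpec : Y ⟶ Spec (CommRingCat.of k)
  [integral : IsIntegral Y]
  [separated : IsSeparated toSpec]
  [locallyOfFiniteType : LocallyOfFiniteType toSpec]
  [quasiCompact : QuasiCompact toSpec]
  normal : ∀ y : Y, IsIntegrallyClosed (Y.presheaf.stalk y)

attribute [instance] NormalVariety.integral NormalVariety.separated
  NormalVariety.locallyOfFiniteType NormalVariety.quasiCompact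

instance {k : Type u} [Field k] (V : NormalVariety k) : IsLocallyNoetherian V.Y :=
  have : IsLocallyNoetherian (Spec (CommRingCat.of k)) := by
    have : IsNoetherianRing (CommRingCat.of k) := inferInstanceAs (IsNoetherianRing k)
    infer_instance
  LocallyOfFiniteType.isLocallyNoetherian V.toSpec

/-- The inclusion of the constants `k` into the function field of a normal variety over `k`. -/
def NormalVariety.constants {k : Type u} [Field k] (V : NormalVariety k) :
    k →+* V.Y.functionField :=
  (V.Y.presheaf.germ ⊤ (genericPoint V.Y) trivial).hom.comp
    (V.toSpec.appTop.hom.comp (Scheme.ΓSpecIso (CommRingCat.of k)).inv.hom)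

section Field

variable (k : Type u) [Field k] (F : Type u) [Field F] [Algebra k F]

/-- The valuations of `F / k` of the form `c • val_D`, where `c` is a positive rational number and
`val_D` is the order along an irreducible divisor `D` (given by its generic point `z`, a point of
codimension one) of a normal variety over `k` whose function field is identified with `F`. -/
def divisorialValuations : Set (AddValuation F (WithTop ℚ)) :=
  {v | ∃ (V : NormalVariety k) (φ : V.Y.functionField ≃+* F)
      (_ : ∀ a : k, φ (V.constants a) = algebraMap k F a)
      (z : V.Y) (_ : Order.coheight z = 1) (c : ℚ) (_ : 0 < c),
    ∀ g : V.Y.functionField, g ≠ 0 → v (φ g) = ((c * (Scheme.ord g z : ℤ) : ℚ) : WithTop ℚ)}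

/-- The discrete valuations of `F` that are trivial on `k`: those whose value group is an infinite
cyclic subgroup `ℤ c` of `ℚ`. -/
def discreteValuations : Set (AddValuation F (WithTop ℚ)) :=
  {v | (∀ a : k, a ≠ 0 → v (algebraMap k F a) = 0) ∧
    ∃ c : ℚ, 0 < c ∧ ∀ q : ℚ, (∃ x : F, v x = (q : WithTop ℚ)) ↔ ∃ n : ℤ, q = n * c}

/-- The trivial valuation of `F`, zero on all nonzero elements (as a one-element set). -/
def trivialValuation : Set (AddValuation F (WithTop ℚ)) :=
  {v | ∀ x : F, x ≠ 0 → v x = 0}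

end Field

section Variety

variable {k : Type u} [Field k] {M : Type u} [AddCommGroup M] (I : Ideal (AddMonoidAlgebra k M))

/-- Characters as elements of the function field `k(X)`. -/
def charFunctionField : Multiplicative M →* FractionRing (CoordRing I) :=
  ((algebraMap (CoordRing I) (FractionRing (CoordRing I))) : _ →* _).comp (charOn I)

end Variety

end GeometricTropicalization

end

open GeometricTropicalization

open GeometricTropicalization

/-! The sets are compared around a cycle: divisorial classes are discrete classes, discrete and
trivial classes are tropical, and nonzero tropical classes are divisorial.

Discrete to tropical: if `v` is discrete (or trivial) on `F = k(X)` and trivial on `k`, the Gauss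
valuation `∑ h_q ε^q ↦ min_q (v(h_q) + q)` on the image of `K[X]` in `F((ε^ℚ))` extends both `v` and
`ord`. The minimum exists because the values `v(h_q)` lie in a lattice `cℤ` and are bounded below,
while the exponents are well ordered (`exists_isLeast_termValues`). Multiplicativity is Gauss's
lemma (`eq_add_of_isLeast_termValues_mul`).

Tropical to divisorial: let `w = [val] ≠ 0`. The group `w(M)` is finitely generated in `ℚ`, hence
equal to `ℤ·w(e)` for some `e` with `w(e) > 0`. Let `A ⊂ k[X]` be generated by the character of `e`
and the characters in `ker w`. It is finitely generated with fraction field `k(X)`. Since `val ≥ 0`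
on `A` and `val` is positive at the character of `e`, that character is not a unit of `A`. Some
prime divisor of the normalization of `Spec A` therefore contains its zero locus. The order along
it, scaled to take the value `w(e)` there, vanishes on `ker w`, whose characters are units of `A`,
and so has class `w`. The normalization is again of finite type (`finiteType_integralClosure`).

Class `0` is the class of the trivial valuation. If `k[X]` is not a field, it is also divisorial: a
valuation that is nonnegative on `k[X]` vanishes on its units, in particular on characters. -/

/-! ### Finiteness of integral closures -/

/-- Over a Noetherian ring, a ring that embeds into a finite one is finite. -/
theorem RingHom.Finite.of_comp_injective {A B C : Type*} [CommRing A] [CommRing B] [CommRing C]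
    [IsNoetherianRing A] {f : A →+* B} {g : B →+* C} (hg : Function.Injective g)
    (h : (g.comp f).Finite) : f.Finite := by
  algebraize [f, g, g.comp f]
  exact Module.Finite.of_injective (IsScalarTower.toAlgHom A B C).toLinearMap hg

/-- The iterated Frobenius endomorphism of a finitely generated algebra over a perfect field is
finite. -/
theorem iterateFrobenius_finite {k : Type*} [Field k] (p : ℕ) [ExpChar k p] [PerfectRing k p]
    (A : Type*) [CommRing A] [Algebra k A] [Algebra.FiniteType k A] [ExpChar A p] (n : ℕ) :
    (iterateFrobenius A p n).Finite := by
  rw [RingHom.finite_iff_isIntegral_and_finiteType]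
  constructor
  · intro x
    refine ⟨Polynomial.X ^ p ^ n - Polynomial.C x,
      Polynomial.monic_X_pow_sub_C x (pow_ne_zero _ (expChar_ne_zero k p)), ?_⟩
    simp [iterateFrobenius_def]
  -- Frobenius is not `k`-linear, but on `k` it is an automorphism followed by the structure map.
  -- Perfectness of `k` enters here.
  · have hcomp : (iterateFrobenius A p n).comp (algebraMap k A) =
        (algebraMap k A).comp (iterateFrobenius k p n) := by
      ext x
      simp [iterateFrobenius_def]
    have : ((iterateFrobenius A p n).comp (algebraMap k A)).FiniteType := by
      rw [hcomp]
      refine RingHom.FiniteType.comp ?_ (RingHom.FiniteType.of_surjective _ ?_)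
      · exact RingHom.finiteType_algebraMap.mpr inferInstance
      · exact (iterateFrobeniusEquiv k p n).surjective
    exact this.of_comp_finiteType

/-- The integral closure of a Noetherian normal domain with finite Frobenius in a finite extension
of its fraction field is finite. -/
theorem finite_integralClosure_of_iterateFrobenius_finite (B : Type*) [CommRing B] [IsDomain B]
    [IsNoetherianRing B] [IsIntegrallyClosed B] (p : ℕ) [ExpChar B p]
    (hB : ∀ n, (iterateFrobenius B p n).Finite)
    (L F : Type*) [Field L] [Algebra B L] [IsFractionRing B L] [Field F] [Algebra L F]
    [Algebra B F] [IsScalarTower B L F] [FiniteDimensional L F] :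
    Module.Finite B (integralClosure B F) := by
  have : ExpChar L p := expChar_of_injective_algebraMap (IsFractionRing.injective B L) p
  have : ExpChar F p := expChar_of_injective_algebraMap (algebraMap L F).injective p
  -- The extension splits into a separable part, where finiteness is classical, and a purely
  -- inseparable part, which a power of Frobenius maps into the separable one.
  let E := separableClosure L F
  have : ExpChar E p := expChar_of_injective_algebraMap (algebraMap L E).injective p
  have : IsScalarTower B E F := IsScalarTower.of_algebraMap_eq fun x => by
    rw [IsScalarTower.algebraMap_apply B L F, IsScalarTower.algebraMap_apply B L E,
      IsScalarTower.algebraMap_apply L E F]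
  have hT : Module.Finite B (integralClosure B E) := IsIntegralClosure.finite B L E _
  let S : Subalgebra B F := (integralClosure B E).map (IsScalarTower.toAlgHom B E F)
  have hS : Module.Finite B S :=
    Module.Finite.of_surjective
      ((IsScalarTower.toAlgHom B E F).subalgebraMap (integralClosure B E)).toLinearMap
      (AlgHom.subalgebraMap_surjective _ _)
  -- The `p^n`-th power embeds the integral closure in `F` into `S`, the image of the integral
  -- closure in `E`.
  let n := IsPurelyInseparable.exponent E F
  let ψ : integralClosure B F →+* S :=
    ((iterateFrobenius F p n).comp (algebraMap (integralClosure B F) F)).codRestrict S <| by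
      intro c
      obtain ⟨e, he⟩ := IsPurelyInseparable.exponent_def' E p (c : F)
      refine ⟨e, ?_, ?_⟩
      · change IsIntegral B e
        rw [← isIntegral_algebraMap_iff (algebraMap E F).injective, he]
        exact c.2.pow _
      · simpa [iterateFrobenius_def] using he
  have hψ : Function.Injective ψ := by
    intro a b hab
    have : iterateFrobenius F p n a = iterateFrobenius F p n b := congrArg Subtype.val hab
    exact Subtype.ext ((iterateFrobenius F p n).injective this)
  -- Along this embedding `B` acts on `S` through its own Frobenius, which is finite, so the target
  -- is finite over the Noetherian ring `B`.
  have hcomp : ψ.comp (algebraMap B (integralClosure B F)) =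
      (algebraMap B S).comp (iterateFrobenius B p n) := by
    ext b
    change iterateFrobenius F p n (algebraMap B F b) = algebraMap B F (iterateFrobenius B p n b)
    simp [iterateFrobenius_def]
  rw [← RingHom.finite_algebraMap]
  refine RingHom.Finite.of_comp_injective hψ ?_
  rw [hcomp]
  exact RingHom.Finite.comp (RingHom.finite_algebraMap.mpr hS) (hB n)

/-- The integral closure of a finitely generated domain over a perfect field, in its field of
fractions, is finitely generated. -/
theorem finiteType_integralClosure (k : Type*) [Field k] [PerfectField k]
    (A : Type*) [CommRing A] [IsDomain A] [Algebra k A] [Algebra.FiniteType k A]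
    (F : Type*) [Field F] [Algebra A F] [IsFractionRing A F] [Algebra k F]
    [IsScalarTower k A F] :
    Algebra.FiniteType k (integralClosure A F) := by
  -- Noether normalization: `A` is finite over a polynomial ring, which is normal with finite
  -- Frobenius.
  obtain ⟨s, g, hg, hgfin⟩ := exists_finite_inj_algHom_of_fg k A
  let B := MvPolynomial (Fin s) k
  let L := FractionRing B
  let : Algebra B A := g.toRingHom.toAlgebra
  have hBA : Module.Finite B A := hgfin
  have : IsScalarTower k B A := IsScalarTower.of_algebraMap_eq fun x => (g.commutes x).symm
  let : Algebra B F := ((algebraMap A F).comp g.toRingHom).toAlgebra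
  have : IsScalarTower B A F := IsScalarTower.of_algebraMap_eq fun _ => rfl
  have : IsScalarTower k B F := IsScalarTower.of_algebraMap_eq fun x => by
    rw [IsScalarTower.algebraMap_apply k A F, IsScalarTower.algebraMap_apply B A F,
      ← IsScalarTower.algebraMap_apply k B A]
  have hBF : Function.Injective (algebraMap B F) := (IsFractionRing.injective A F).comp hg
  have : FaithfulSMul B F := (faithfulSMul_iff_algebraMap_injective _ _).2 hBF
  let : Algebra L F := FractionRing.liftAlgebra B F
  have : IsScalarTower B L F := FractionRing.isScalarTower_liftAlgebra B F
  have : IsScalarTower k L F := IsScalarTower.of_algebraMap_eq fun x => by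
    rw [IsScalarTower.algebraMap_apply k B F, IsScalarTower.algebraMap_apply B L F,
      ← IsScalarTower.algebraMap_apply k B L]
  have : Algebra.IsAlgebraic L F := isAlgebraic_of_isFractionRing B A L F
  have : Algebra.EssFiniteType A F := .of_isLocalization F (nonZeroDivisors A)
  have : Algebra.EssFiniteType k F := .comp k A F
  have : Algebra.EssFiniteType L F := .of_comp k L F
  have : FiniteDimensional L F := Algebra.finite_of_essFiniteType_of_isAlgebraic
  let p := ringExpChar k
  have : ExpChar B p := expChar_of_injective_algebraMap (algebraMap k B).injective p
  have hfin : Module.Finite B (integralClosure B F) :=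
    finite_integralClosure_of_iterateFrobenius_finite B p (iterateFrobenius_finite (k := k) p B) L F
  -- Both closures agree because `A` is integral over `B`.
  have hle : ∀ x, x ∈ integralClosure A F ↔ x ∈ integralClosure B F := fun x =>
    ⟨fun hx => isIntegral_trans x hx, fun hx => IsIntegral.tower_top hx⟩
  let e : integralClosure B F →ₗ[B] integralClosure A F :=
    { toFun := fun x => ⟨x, (hle x).2 x.2⟩
      map_add' := fun _ _ => rfl
      map_smul' := fun b x => Subtype.ext <| by
        rw [Algebra.smul_def, RingHom.id_apply, Algebra.smul_def]
        rfl }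
  have hfin' : Module.Finite B (integralClosure A F) :=
    Module.Finite.of_surjective e fun x => ⟨⟨x, (hle x).1 x.2⟩, rfl⟩
  have : IsScalarTower k B (integralClosure A F) :=
    IsScalarTower.of_algebraMap_eq fun x => Subtype.ext (IsScalarTower.algebraMap_apply k B F x)
  exact Algebra.FiniteType.trans (S := B) inferInstance inferInstance

/-! ### Divisors on normal varieties -/

/-- A nonzero nonunit of a Noetherian domain lies in a prime ideal of height one. -/
theorem exists_isPrime_height_eq_one_mem {C : Type*} [CommRing C] [IsDomain C]
    [IsNoetherianRing C] {x : C} (hx0 : x ≠ 0) (hx : ¬IsUnit x) :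
    ∃ q : Ideal C, q.IsPrime ∧ q.height = 1 ∧ x ∈ q := by
  obtain ⟨m, hm, hxm⟩ := exists_max_ideal_of_mem_nonunits hx
  obtain ⟨q, hq, -⟩ := Ideal.exists_minimalPrimes_le ((Ideal.span_singleton_le_iff_mem m).2 hxm)
  have hxq : x ∈ q := (Ideal.span_singleton_le_iff_mem q).1 hq.1.2
  have hqp : q.IsPrime := hq.1.1
  -- Krull's principal ideal theorem bounds the height above; `x ≠ 0` excludes height zero.
  refine ⟨q, hqp, le_antisymm
    (Ideal.height_le_one_of_isPrincipal_of_mem_minimalPrimes (Ideal.span {x}) q hq) ?_, hxq⟩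
  rw [Order.one_le_iff_ne_zero]
  intro h0
  rw [Ideal.height_eq_zero_iff, IsDomain.minimalPrimes_eq_singleton_bot] at h0
  rw [Set.mem_singleton_iff.1 h0] at hxq
  exact hx0 hxq

section

open AlgebraicGeometry CategoryTheory

/-- The local ring of a normal variety at a point of codimension one is a discrete valuation
ring. -/
theorem NormalVariety.isDiscreteValuationRing_stalk {k : Type u} [Field k] (V : NormalVariety k)
    {z : V.Y} (hz : Order.coheight z = 1) : IsDiscreteValuationRing (V.Y.presheaf.stalk z) := by
  have hdim := ringKrullDim_stalk_eq_coheight z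
  have hfield : ¬IsField (V.Y.presheaf.stalk z) := fun h => by
    rw [ringKrullDim_eq_zero_of_isField h, hz] at hdim
    exact zero_ne_one hdim
  have := V.normal z
  have : Ring.KrullDimLE 1 (V.Y.presheaf.stalk z) := krullDimLE_of_coheight_le hz.le
  have : Ring.DimensionLEOne (V.Y.presheaf.stalk z) :=
    ⟨fun hp hp' => hp'.isMaximal_of_ne_bot hp⟩
  have : IsDedekindDomain (V.Y.presheaf.stalk z) := {}
  exact ((IsDiscreteValuationRing.TFAE _ hfield).out 0 2).2 this

/-! ### Orders of vanishing as valuations. -/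

section Ord

variable {X : Scheme.{u}} [IsIntegral X] [IsLocallyNoetherian X]

theorem ord_germToFunctionField_nonneg {U : X.Opens} [Nonempty U] {z : X} (hzU : z ∈ U)
    {f : Γ(X, U)} (hf : f ≠ 0) : 0 ≤ Scheme.ord (X.germToFunctionField U f) z := by
  have h := Scheme.ord_le_smul hzU hf (1 : X.functionField)
  have h1 : Scheme.ord (1 : X.functionField) z = 0 := by
    have := Scheme.ord_mul (x := z) (one_ne_zero (α := X.functionField)) one_ne_zero
    rw [mul_one] at this
    omega
  rwa [h1, Algebra.smul_def, mul_one] at h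

/-- In a discrete valuation ring the elements of order zero are exactly the units, so a nonunit germ
cannot have order zero. -/
theorem ord_germToFunctionField_pos {U : X.Opens} [Nonempty U] {z : X} (hzU : z ∈ U)
    (hz : Order.coheight z = 1) [IsDiscreteValuationRing (X.presheaf.stalk z)]
    {f : Γ(X, U)} (hf : f ≠ 0) (hfz : ¬IsUnit (X.presheaf.germ U z hzU f)) :
    0 < Scheme.ord (X.germToFunctionField U f) z := by
  refine lt_of_le_of_ne (ord_germToFunctionField_nonneg hzU hf) fun h0 => hfz ?_
  have hf' : X.germToFunctionField U f ≠ 0 := by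
    rwa [Ne, map_eq_zero_iff _ (Scheme.germToFunctionField_injective X U)]
  have h := (Scheme.ord_eq_iff hz hf').1 h0.symm
  rw [← Scheme.algebraMap_germ_eq_germToFunctionField X hzU] at h
  exact (Ring.isUnit_iff_ordFrac_one_of_isDiscreteValuationRing (K := X.functionField)).2 h

theorem exists_ord_eq_one {z : X} (hz : Order.coheight z = 1)
    [IsDiscreteValuationRing (X.presheaf.stalk z)] :
    ∃ f : X.functionField, f ≠ 0 ∧ Scheme.ord f z = 1 := by
  obtain ⟨ϖ, hϖ⟩ := IsDiscreteValuationRing.exists_irreducible (X.presheaf.stalk z)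
  have h0 : algebraMap (X.presheaf.stalk z) X.functionField ϖ ≠ 0 := by
    rw [Ne, map_eq_zero_iff _ (IsFractionRing.injective _ _)]
    exact hϖ.ne_zero
  exact ⟨_, h0, (Scheme.ord_eq_iff hz h0).2 (Ring.ordFrac_irreducible hϖ)⟩

/-- A multiple of the order along a divisor, transported to a field isomorphic to the function
field, as a valuation. -/
noncomputable def ordAddValuation {F : Type u} [Field F] (φ : X.functionField ≃+* F) (z : X)
    [IsDiscreteValuationRing (X.presheaf.stalk z)] (c : ℚ) (hc : 0 < c) :
    AddValuation F (WithTop ℚ) :=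
  open Classical in
  AddValuation.of
    -- `Scheme.ord` is integer-valued, so the value `⊤` at zero is imposed separately.
    (fun x => if x = 0 then ⊤ else ((c * (Scheme.ord (φ.symm x) z : ℤ) : ℚ) : WithTop ℚ))
    (if_pos rfl)
    (by
      have := Scheme.ord_mul (x := z) (one_ne_zero (α := X.functionField)) one_ne_zero
      rw [mul_one] at this
      have h1 : Scheme.ord (1 : X.functionField) z = 0 := by omega
      simp [h1])
    (by
      intro x y
      by_cases hx : x = 0
      · rw [hx, if_pos rfl, zero_add]
        exact min_le_right _ _
      by_cases hy : y = 0
      · rw [hy, if_pos rfl, add_zero]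
        exact min_le_left _ _
      by_cases hxy : x + y = 0
      · simp [hxy]
      simp only [hx, hy, hxy, if_false]
      have h := Scheme.ord_add (x := z) (f := φ.symm x) (g := φ.symm y)
        (by rwa [← map_add, Ne, map_eq_zero_iff _ φ.symm.injective])
      rw [← map_add] at h
      rw [min_le_iff] at h ⊢
      refine h.imp (fun h => ?_) (fun h => ?_) <;>
      · rw [WithTop.coe_le_coe]
        exact mul_le_mul_of_nonneg_left (by exact_mod_cast h) hc.le)
    (by
      intro x y
      by_cases hx : x = 0
      · simp [hx]
      by_cases hy : y = 0
      · simp [hy]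
      simp only [hx, hy, mul_eq_zero, or_self, if_false]
      rw [map_mul, Scheme.ord_mul (by rwa [Ne, map_eq_zero_iff _ φ.symm.injective])
        (by rwa [Ne, map_eq_zero_iff _ φ.symm.injective]), ← WithTop.coe_add]
      congr 1
      push_cast
      ring)

theorem ordAddValuation_apply {F : Type u} [Field F] (φ : X.functionField ≃+* F) (z : X)
    [IsDiscreteValuationRing (X.presheaf.stalk z)] (c : ℚ) (hc : 0 < c) {g : X.functionField}
    (hg : g ≠ 0) :
    ordAddValuation φ z c hc (φ g) = ((c * (Scheme.ord g z : ℤ) : ℚ) : WithTop ℚ) := by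
  have : φ g ≠ 0 := by rwa [Ne, map_eq_zero_iff _ φ.injective]
  simp [ordAddValuation, hg]

end Ord

/-- Divisorial valuations are discrete. -/
theorem divisorialValuations_subset_discreteValuations (k : Type u) [Field k] (F : Type u)
    [Field F] [Algebra k F] : divisorialValuations k F ⊆ discreteValuations k F := by
  rintro v ⟨V, φ, hφ, z, hz, c, hc, hv⟩
  have := NormalVariety.isDiscreteValuationRing_stalk V hz
  refine ⟨fun a ha => ?_, c, hc, fun q => ⟨?_, ?_⟩⟩
  · have : Nonempty (⊤ : V.Y.Opens) := ⟨⟨z, trivial⟩⟩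
    have hne : V.constants a ≠ 0 := by
      rwa [Ne, map_eq_zero]
    rw [← hφ, hv _ hne]
    have hu : IsUnit (V.toSpec.appTop.hom ((Scheme.ΓSpecIso (CommRingCat.of k)).inv.hom a)) :=
      ((IsUnit.mk0 a ha).map _).map _
    have : Scheme.ord (V.constants a) z = 0 := Scheme.ord_of_isUnit (U := ⊤) hu trivial
    simp [this]
  · rintro ⟨x, hx⟩
    obtain ⟨g, rfl⟩ := φ.surjective x
    have hg : g ≠ 0 := by
      rintro rfl
      simp at hx
    rw [hv g hg, WithTop.coe_inj] at hx
    exact ⟨_, by rw [← hx, mul_comm]⟩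
  · rintro ⟨n, rfl⟩
    obtain ⟨f, hf, hf1⟩ := exists_ord_eq_one hz
    refine ⟨φ (f ^ n), ?_⟩
    rw [hv _ (zpow_ne_zero n hf)]
    have : Scheme.ord (f ^ n) z = n := by
      rw [Scheme.ord_eq_iff hz (zpow_ne_zero n hf), map_zpow₀, (Scheme.ord_eq_iff hz hf).1 hf1]
      rw [← WithZero.coe_zpow, ← ofAdd_zsmul]
      simp
    rw [this, mul_comm]

end

/-! ### Divisorial valuations from affine normal models. -/

section

open AlgebraicGeometry CategoryTheory

/-- The spectrum of a finitely generated normal domain, as a normal variety. -/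
noncomputable def NormalVariety.ofAffine (k : Type u) [Field k] (C : Type u) [CommRing C]
    [IsDomain C] [IsIntegrallyClosed C] [Algebra k C] [Algebra.FiniteType k C] :
    NormalVariety k where
  Y := Spec (CommRingCat.of C)
  toSpec := Spec.map (CommRingCat.ofHom (algebraMap k C))
  integral := inferInstanceAs (AlgebraicGeometry.IsIntegral (Spec (CommRingCat.of C)))
  locallyOfFiniteType := by
    rw [HasRingHomProperty.Spec_iff (P := @LocallyOfFiniteType)]
    exact RingHom.finiteType_algebraMap.mpr inferInstance
  normal := fun (y : PrimeSpectrum C) => isIntegrallyClosed_of_isLocalization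
    (R := C) ((Spec.structureSheaf C).presheaf.stalk y) y.asIdeal.primeCompl
    y.asIdeal.primeCompl_le_nonZeroDivisors

/-- The prime ideals of height one of a finitely generated normal domain define divisorial
valuations of its field of fractions. -/
theorem exists_mem_divisorialValuations_of_height_eq_one (k : Type u) [Field k] (C : Type u)
    [CommRing C] [IsDomain C] [IsIntegrallyClosed C] [Algebra k C] [Algebra.FiniteType k C]
    (F : Type u) [Field F] [Algebra C F] [IsFractionRing C F] [Algebra k F] [IsScalarTower k C F]
    (q : Ideal C) (hq : q.IsPrime) (hq1 : q.height = 1) {x : C} (hx : x ∈ q) (hx0 : x ≠ 0)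
    (c : ℚ) (hc : 0 < c) :
    ∃ v ∈ divisorialValuations k F, (∀ a : C, 0 ≤ v (algebraMap C F a)) ∧
      v (algebraMap C F x) = (c : WithTop ℚ) := by
  let V := NormalVariety.ofAffine k C
  let z : V.Y := (⟨q, hq⟩ : PrimeSpectrum C)
  have hz : Order.coheight z = 1 := by
    rw [← hq1]
    exact (idealHeight_eq_coheight (CommRingCat.of C) ⟨q, hq⟩).symm
  have := NormalVariety.isDiscreteValuationRing_stalk V hz
  have : Nonempty (⊤ : V.Y.Opens) := ⟨⟨z, trivial⟩⟩
  have hfrac : IsFractionRing Γ(V.Y, ⊤) V.Y.functionField :=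
    functionField_isFractionRing_of_isAffineOpen V.Y ⊤
      (isAffineOpen_top (Spec (CommRingCat.of C)))
  let e : Γ(V.Y, ⊤) ≃+* C := (Scheme.ΓSpecIso (CommRingCat.of C)).commRingCatIsoToRingEquiv
  let φ : V.Y.functionField ≃+* F := IsFractionRing.ringEquivOfRingEquiv e
  have hφ : ∀ a : C, φ (V.Y.germToFunctionField ⊤ (e.symm a)) = algebraMap C F a := fun a => by
    have := IsFractionRing.ringEquivOfRingEquiv_algebraMap (K := V.Y.functionField) (L := F) e
      (e.symm a)
    rwa [e.apply_symm_apply] at this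
  have hne : ∀ a : C, a ≠ 0 → V.Y.germToFunctionField ⊤ (e.symm a) ≠ 0 := fun a ha => by
    rwa [Ne, map_eq_zero_iff _ (Scheme.germToFunctionField_injective V.Y ⊤),
      map_eq_zero_iff _ e.symm.injective]
  have hes : ∀ a : C, a ≠ 0 → e.symm a ≠ 0 := fun a ha => by
    rwa [Ne, map_eq_zero_iff _ e.symm.injective]
  -- The germ of `x` at `z` is not a unit because `x ∈ q`, that is, `z` lies outside the basic open
  -- set of `x`.
  have hpos := ord_germToFunctionField_pos (U := ⊤) trivial hz (hes x hx0) (by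
    rw [← Scheme.mem_basicOpen_top]
    intro hmem
    have h := basicOpen_eq_of_affine (R := CommRingCat.of C) x
    have hmem' : z ∈ PrimeSpectrum.basicOpen x := h ▸ hmem
    exact hmem' hx)
  set N : ℤ := Scheme.ord (V.Y.germToFunctionField ⊤ (e.symm x)) z
  have hN : (0 : ℚ) < N := by exact_mod_cast hpos
  -- Dividing by the order `N` of `x` makes the value at `x` exactly `c`.
  have hd : 0 < c / N := div_pos hc hN
  have hv : ∀ a : C, a ≠ 0 → ordAddValuation φ z (c / N) hd (algebraMap C F a) =
      ((c / N * (Scheme.ord (V.Y.germToFunctionField ⊤ (e.symm a)) z : ℤ) : ℚ) : WithTop ℚ) :=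
    fun a ha => by rw [← hφ, ordAddValuation_apply φ z _ hd (hne a ha)]
  refine ⟨ordAddValuation φ z _ hd, ⟨V, φ, fun a => ?_, z, hz, c / N, hd, fun g hg =>
    ordAddValuation_apply φ z _ hd hg⟩, fun a => ?_, ?_⟩
  · rw [IsScalarTower.algebraMap_apply k C F, ← hφ]
    congr 1
    change V.Y.germToFunctionField ⊤ _ = _
    congr 1
    exact congrArg (fun f => f.hom a)
      (Scheme.ΓSpecIso_inv_naturality (CommRingCat.ofHom (algebraMap k C))).symm
  · by_cases ha : a = 0
    · simp [ha]
    · rw [hv a ha]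
      have := ord_germToFunctionField_nonneg (U := ⊤) (z := z) trivial (hes a ha)
      exact_mod_cast mul_nonneg hd.le (by exact_mod_cast this)
  · rw [hv x hx0, div_mul_cancel₀ c hN.ne']

/-- A nonzero nonunit of a finitely generated domain over a perfect field is positive for some
divisorial valuation of the field of fractions that is nonnegative on the domain. -/
theorem exists_mem_divisorialValuations (k : Type u) [Field k] [PerfectField k] (A : Type u)
    [CommRing A] [IsDomain A] [Algebra k A] [Algebra.FiniteType k A]
    (F : Type u) [Field F] [Algebra A F] [IsFractionRing A F] [Algebra k F] [IsScalarTower k A F]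
    {x : A} (hx0 : x ≠ 0) (hx : ¬IsUnit x) (c : ℚ) (hc : 0 < c) :
    ∃ v ∈ divisorialValuations k F, (∀ a : A, 0 ≤ v (algebraMap A F a)) ∧
      v (algebraMap A F x) = (c : WithTop ℚ) := by
  let C := integralClosure A F
  have : Algebra.FiniteType k C := finiteType_integralClosure k A F
  have : IsNoetherianRing C := Algebra.FiniteType.isNoetherianRing k C
  have : IsFractionRing C F := integralClosure.isFractionRing_of_finite_extension F F
  have : IsIntegrallyClosed C := integralClosure.isIntegrallyClosedOfFiniteExtension F
  have hinj : Function.Injective (algebraMap A C) := fun a b hab =>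
    IsFractionRing.injective A F (congrArg Subtype.val hab)
  have : FaithfulSMul A C := (faithfulSMul_iff_algebraMap_injective _ _).2 hinj
  have hx0' : algebraMap A C x ≠ 0 := by rwa [Ne, map_eq_zero_iff _ hinj]
  -- A nonunit of `A` stays a nonunit in the integral extension `C`.
  obtain ⟨q, hq, hq1, hxq⟩ := exists_isPrime_height_eq_one_mem hx0'
    fun h => hx (isUnit_of_map_unit (algebraMap A C) x h)
  obtain ⟨v, hv, hv0, hvx⟩ :=
    exists_mem_divisorialValuations_of_height_eq_one k C F q hq hq1 hxq hx0' c hc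
  exact ⟨v, hv, fun a => hv0 (algebraMap A C a), hvx⟩

end

/-! ### From points of the tropical variety to divisors -/

theorem coe_bracket {M : Type*} [AddCommGroup M] {R : Type*} [Ring R] (χ : Multiplicative M →* R)
    (v : AddValuation R (WithTop ℚ)) (m : M) :
    (bracket χ v m : WithTop ℚ) = v (χ (Multiplicative.ofAdd m)) :=
  WithTop.coe_untop _ _

/-- The image of a nonzero homomorphism from a finitely generated group to `ℚ` is generated by a
positive element. -/
theorem exists_pos_forall_eq_zsmul {M : Type*} [AddCommGroup M] [Module.Finite ℤ M] {w : M →+ ℚ}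
    (hw : w ≠ 0) : ∃ e : M, 0 < w e ∧ ∀ m : M, ∃ n : ℤ, w m = w (n • e) := by
  have hfg : (LinearMap.range w.toIntLinearMap).FG := by
    rw [LinearMap.range_eq_map]
    exact Module.Finite.fg_top.map _
  -- A finitely generated subgroup of `ℚ` is a fractional ideal of the principal ideal domain `ℤ`,
  -- hence cyclic.
  let J : FractionalIdeal (nonZeroDivisors ℤ) ℚ := ⟨_, FractionalIdeal.isFractional_of_fg hfg⟩
  have hJ : (J : Submodule ℤ ℚ).IsPrincipal := inferInstance
  obtain ⟨g, hg⟩ := hJ.principal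
  change LinearMap.range w.toIntLinearMap = _ at hg
  have hgmem : g ∈ LinearMap.range w.toIntLinearMap := hg ▸ Submodule.mem_span_singleton_self g
  obtain ⟨e, he⟩ := hgmem
  change w e = g at he
  have hgen : ∀ m : M, ∃ n : ℤ, w m = w (n • e) := fun m => by
    have hm : w m ∈ LinearMap.range w.toIntLinearMap := ⟨m, rfl⟩
    rw [hg, Submodule.mem_span_singleton] at hm
    obtain ⟨n, hn⟩ := hm
    exact ⟨n, by rw [map_zsmul, he, hn]⟩
  have he0 : w e ≠ 0 := fun h => hw <| by
    ext m
    obtain ⟨n, hn⟩ := hgen m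
    rw [hn, map_zsmul, h, smul_zero, AddMonoidHom.zero_apply]
  rcases lt_or_gt_of_ne he0 with h | h
  · refine ⟨-e, by rw [map_neg]; linarith, fun m => ?_⟩
    obtain ⟨n, hn⟩ := hgen m
    exact ⟨-n, by rw [neg_smul_neg, hn]⟩
  · exact ⟨e, h, hgen⟩

section

variable {k : Type u} [Field k] [PerfectField k] {M : Type u} [AddCommGroup M]
  {R : Type u} [CommRing R] [IsDomain R] [Algebra k R] (χ : Multiplicative M →* R)
  (F : Type u) [Field F] [Algebra R F] [IsFractionRing R F] [Algebra k F] [IsScalarTower k R F]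

/-- If `R` is finitely generated and is not a field, then some divisorial valuation vanishes on
all characters. -/
theorem exists_mem_divisorialValuations_bracket_eq_zero [Algebra.FiniteType k R]
    (hR : ¬IsField R) :
    ∃ v ∈ divisorialValuations k F,
      bracket ((algebraMap R F : R →* F).comp χ) v = 0 := by
  obtain ⟨x, hx0, hx⟩ := Ring.exists_not_isUnit_of_not_isField hR
  obtain ⟨v, hv, hv0, -⟩ := exists_mem_divisorialValuations k R F hx0 hx 1 one_pos
  have h : ∀ m, 0 ≤ bracket ((algebraMap R F : R →* F).comp χ) v m := fun m => by
    rw [← WithTop.coe_le_coe, coe_bracket]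
    exact hv0 _
  refine ⟨v, hv, ?_⟩
  ext m
  -- Characters are units of `R`: nonnegativity at `m` and `-m` forces the value zero.
  have := h (-m)
  rw [map_neg] at this
  exact le_antisymm (neg_nonneg.1 this) (h m)

/-- A nonzero homomorphism `M → ℚ` defined by a valuation of `R` that is trivial on `k` is defined
by a divisorial valuation. -/
theorem exists_mem_divisorialValuations_bracket_eq [Module.Finite ℤ M]
    (hχ : Submodule.span k (Set.range χ) = ⊤)
    (val : AddValuation R (WithTop ℚ)) (hval : ∀ a : k, 0 ≤ val (algebraMap k R a))
    (hw : bracket χ val ≠ 0) :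
    ∃ v ∈ divisorialValuations k F,
      bracket ((algebraMap R F : R →* F).comp χ) v = bracket χ val := by
  set w := bracket χ val with hwdef
  obtain ⟨e, he, hgen⟩ := exists_pos_forall_eq_zsmul hw
  let ch : M → R := fun m => χ (Multiplicative.ofAdd m)
  have ch_add : ∀ a b, ch (a + b) = ch a * ch b := fun a b => by
    simp only [ch, ofAdd_add, map_mul]
  have ch_ne : ∀ a, ch a ≠ 0 := fun a => ((Group.isUnit _).map χ).ne_zero
  obtain ⟨S, hS⟩ : (LinearMap.ker w.toIntLinearMap).FG := IsNoetherian.noetherian _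
  -- Only `ch e` is taken without its inverse, so that it can be a nonunit of `A`; the characters in
  -- `ker w` are made invertible.
  let T : Set R := insert (ch e) (ch '' S ∪ (fun m => ch (-m)) '' S)
  have hTfin : T.Finite :=
    ((S.finite_toSet.image _).union (S.finite_toSet.image _)).insert _
  let A : Subalgebra k R := Algebra.adjoin k T
  have hAfin : Algebra.FiniteType k A :=
    (Subalgebra.fg_iff_finiteType A).1 ⟨hTfin.toFinset, by rw [hTfin.coe_toFinset]⟩
  have hSw : ∀ m ∈ S, w m = 0 := fun m hm => by
    have : m ∈ LinearMap.ker w.toIntLinearMap := hS ▸ Submodule.subset_span hm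
    exact this
  have hker : ∀ m, w m = 0 → ch m ∈ A := by
    let H : AddSubgroup M :=
      { carrier := {m | ch m ∈ A ∧ ch (-m) ∈ A}
        zero_mem' := by simp [ch]
        add_mem' := fun ha hb => by
          refine ⟨?_, ?_⟩
          · rw [ch_add]
            exact mul_mem ha.1 hb.1
          · rw [neg_add, ch_add]
            exact mul_mem ha.2 hb.2
        neg_mem' := fun ha => ⟨ha.2, by rw [neg_neg]; exact ha.1⟩ }
    have hle : Submodule.span ℤ (S : Set M) ≤ AddSubgroup.toIntSubmodule H := by
      rw [Submodule.span_le]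
      intro m hm
      exact ⟨Algebra.subset_adjoin (.inr (.inl ⟨m, hm, rfl⟩)),
        Algebra.subset_adjoin (.inr (.inr ⟨m, hm, rfl⟩))⟩
    intro m hm
    have hm' : m ∈ Submodule.span ℤ (S : Set M) := hS ▸ hm
    exact (hle hm').1
  have hpow : ∀ n : ℕ, ch (n • e) ∈ A := fun n => by
    have : ch (n • e) = ch e ^ n := by simp only [ch, ofAdd_nsmul, map_pow]
    rw [this]
    exact pow_mem (Algebra.subset_adjoin (Set.mem_insert _ _)) n
  -- Powers of `ch e` clear all denominators: `R` is `A` with `ch e` inverted.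
  have hdenom : ∀ r : R, ∃ n : ℕ, ch (n • e) * r ∈ A := fun r => by
    have hr : r ∈ Submodule.span k (Set.range χ) := hχ ▸ Submodule.mem_top
    induction hr using Submodule.span_induction with
    | mem r hr =>
      obtain ⟨m, rfl⟩ := hr
      obtain ⟨n, hn⟩ := hgen m.toAdd
      refine ⟨n.natAbs, ?_⟩
      -- The exponent splits into `m - n•e ∈ ker w` and a multiple of `e` by `|n| + n ≥ 0`.
      have h1 : ch (n.natAbs • e) * χ m = ch (m.toAdd - n • e) * ch ((n.natAbs + n).toNat • e) := by
        change ch (n.natAbs • e) * ch m.toAdd = _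
        rw [← ch_add, ← ch_add]
        congr 1
        have : ((n.natAbs + n).toNat • e : M) = ((n.natAbs + n : ℤ)) • e := by
          rw [← natCast_zsmul, Int.toNat_of_nonneg (by omega)]
        rw [this, add_smul, natCast_zsmul]
        abel
      rw [h1]
      exact mul_mem (hker _ (by rw [map_sub, hn, sub_self])) (hpow _)
    | zero => exact ⟨0, by rw [mul_zero]; exact zero_mem _⟩
    | add x y _ _ hx hy =>
      obtain ⟨a, ha⟩ := hx
      obtain ⟨b, hb⟩ := hy
      refine ⟨a + b, ?_⟩
      have : ch ((a + b) • e) * (x + y) =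
          ch (b • e) * (ch (a • e) * x) + ch (a • e) * (ch (b • e) * y) := by
        rw [add_smul, ch_add]
        ring
      rw [this]
      exact add_mem (mul_mem (hpow _) ha) (mul_mem (hpow _) hb)
    | smul c x _ hx =>
      obtain ⟨a, ha⟩ := hx
      exact ⟨a, by rw [mul_smul_comm]; exact A.smul_mem ha c⟩
  have hRF : Function.Injective (algebraMap R F) := IsFractionRing.injective R F
  have hfaith : FaithfulSMul A F := (faithfulSMul_iff_algebraMap_injective _ _).2
    (hRF.comp Subtype.val_injective)
  have hfrac : IsFractionRing A F := by
    refine IsFractionRing.of_field _ _ fun z => ?_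
    obtain ⟨r, s, hs, rfl⟩ := IsFractionRing.div_surjective (A := R) z
    have hs0 : algebraMap R F s ≠ 0 := by
      rw [Ne, map_eq_zero_iff _ hRF]
      exact nonZeroDivisors.ne_zero hs
    obtain ⟨a, ha⟩ := hdenom r
    obtain ⟨b, hb⟩ := hdenom s
    refine ⟨⟨_, mul_mem (hpow b) ha⟩, ⟨_, mul_mem (hpow a) hb⟩, ?_⟩
    change _ = algebraMap R F (ch (b • e) * (ch (a • e) * r)) /
      algebraMap R F (ch (a • e) * (ch (b • e) * s))
    have hne : ∀ m, algebraMap R F (ch m) ≠ 0 := fun m => by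
      rw [Ne, map_eq_zero_iff _ hRF]
      exact ch_ne m
    have h1 := hne (a • e)
    have h2 := hne (b • e)
    simp only [map_mul]
    field_simp
  have hch : ∀ m, val (ch m) = (w m : WithTop ℚ) := fun m => (coe_bracket χ val m).symm
  have hnonneg : ∀ a ∈ A, 0 ≤ val a := fun a ha => by
    induction ha using Algebra.adjoin_induction with
    | mem a ha =>
      rcases ha with rfl | ⟨m, hm, rfl⟩ | ⟨m, hm, rfl⟩
      · rw [hch]
        exact_mod_cast he.le
      · rw [hch, hSw m hm]
        exact le_rfl
      · simp only [hch, map_neg, hSw m hm, neg_zero]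
        exact le_rfl
    | algebraMap c => exact hval c
    | add x y _ _ hx hy => exact (le_min hx hy).trans (val.map_add x y)
    | mul x y _ _ hx hy =>
      rw [val.map_mul]
      exact add_nonneg hx hy
  let x : A := ⟨ch e, Algebra.subset_adjoin (Set.mem_insert _ _)⟩
  have hx0 : x ≠ 0 := fun h => ch_ne e (congrArg Subtype.val h)
  -- An inverse in `A` would have nonnegative value, while `ch e` has positive value.
  have hx : ¬IsUnit x := fun h => by
    obtain ⟨y, hy⟩ := h.exists_right_inv
    have h1 : val (ch e * y) = 0 := by
      rw [← val.map_one]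
      exact congrArg (fun a : A => val a) hy
    have h2 : (0 : WithTop ℚ) < val (ch e) := by
      rw [hch]
      exact_mod_cast he
    rw [val.map_mul] at h1
    exact absurd h1 (add_pos_of_pos_of_nonneg h2 (hnonneg y y.2)).ne'
  obtain ⟨v, hv, hv0, hvx⟩ := exists_mem_divisorialValuations k A F hx0 hx (w e) he
  refine ⟨v, hv, ?_⟩
  set b := bracket ((algebraMap R F : R →* F).comp χ) v with hb
  have hbch : ∀ m, (b m : WithTop ℚ) = v (algebraMap R F (ch m)) := fun m => coe_bracket _ _ m
  have hb0 : ∀ m, w m = 0 → 0 ≤ b m := fun m hm => by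
    rw [← WithTop.coe_le_coe, hbch]
    exact hv0 ⟨_, hker m hm⟩
  have hbe : b e = w e := by
    rw [← WithTop.coe_inj, hbch]
    exact hvx
  ext m
  obtain ⟨n, hn⟩ := hgen m
  -- `b` is nonnegative at this element of `ker w` and at its negative, so it vanishes there;
  -- together with `b e = w e` this determines `b`.
  have h1 : w (m - n • e) = 0 := by rw [map_sub, hn, sub_self]
  have h2 := hb0 _ h1
  have h3 := hb0 (-(m - n • e)) (by rw [map_neg, h1, neg_zero])
  rw [map_neg] at h3
  have h4 : b (m - n • e) = 0 := le_antisymm (by linarith) h2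
  rw [map_sub, sub_eq_zero] at h4
  rw [h4, hn, map_zsmul, map_zsmul, hbe]

end

/-! ### Gauss valuations -/

/-- Every valuation of a commutative ring is induced from a field. -/
theorem isRingValuation_of_commRing {R : Type u} [CommRing R]
    (val : AddValuation R (WithTop ℚ)) : IsRingValuation val := by
  -- Modulo its support the valuation is infinite only at zero, hence extends to the fraction field
  -- of the quotient.
  let V : Valuation R (Multiplicative (WithTop ℚ)ᵒᵈ) := AddValuation.toValuation val
  let W : Valuation (R ⧸ V.supp) (Multiplicative (WithTop ℚ)ᵒᵈ) := V.onQuot le_rfl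
  have hsupp : W.supp = ⊥ := V.supp_quot_supp
  have hle : nonZeroDivisors (R ⧸ V.supp) ≤ W.supp.primeCompl := fun a ha h =>
    nonZeroDivisors.ne_zero ha (by
      have h' : a ∈ W.supp := h
      rwa [hsupp] at h')
  let L := FractionRing (R ⧸ V.supp)
  let U : Valuation L (Multiplicative (WithTop ℚ)ᵒᵈ) := W.extendToLocalization hle L
  refine ⟨L, inferInstance, (algebraMap (R ⧸ V.supp) L).comp (Ideal.Quotient.mk V.supp),
    AddValuation.ofValuation U, ?_⟩
  refine Valuation.ext fun r => ?_
  exact (W.extendToLocalization_apply_map_apply hle L (Ideal.Quotient.mk _ r)).symm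

section

variable {F : Type u} [Field F] (v : AddValuation F (WithTop ℚ))

/-- The values `v(h_q) + q` of the terms of the series `h = ∑ h_q ε^q`. -/
def termValues (h : HahnSeries ℚ F) : Set (WithTop ℚ) :=
  Set.range fun q : ℚ => v (h.coeff q) + (q : WithTop ℚ)

theorem le_add_coe_iff (a : WithTop ℚ) (x q : ℚ) :
    (x : WithTop ℚ) ≤ a + (q : WithTop ℚ) ↔ ((x - q : ℚ) : WithTop ℚ) ≤ a := by
  cases a with
  | top => simp
  | coe a => rw [← WithTop.coe_add, WithTop.coe_le_coe, WithTop.coe_le_coe, sub_le_iff_le_add]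

theorem isLeast_termValues_zero : IsLeast (termValues v 0) ⊤ :=
  ⟨⟨0, by simp⟩, by rintro _ ⟨q, rfl⟩; simp⟩

theorem eq_zero_of_isLeast_termValues_top {h : HahnSeries ℚ F} (hh : IsLeast (termValues v h) ⊤) :
    h = 0 := by
  ext q
  have h1 := top_le_iff.1 (hh.2 ⟨q, rfl⟩)
  rcases WithTop.add_eq_top.1 h1 with h2 | h2
  · exact v.top_iff.1 h2
  · exact absurd h2 WithTop.coe_ne_top

theorem isLeast_termValues_C (a : F) : IsLeast (termValues v (HahnSeries.C a)) (v a) := by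
  refine ⟨⟨0, by simp⟩, ?_⟩
  rintro _ ⟨q, rfl⟩
  rw [HahnSeries.C_apply]
  by_cases hq : q = 0
  · simp [hq]
  · simp [HahnSeries.coeff_single_of_ne hq]

/-- If `v` is discrete, a series whose coefficients have bounded below values has a least term
value. -/
theorem exists_isLeast_termValues {c : ℚ} (hc : 0 < c)
    (hv : ∀ x : F, x ≠ 0 → ∃ n : ℤ, v x = ((n * c : ℚ) : WithTop ℚ)) (h : HahnSeries ℚ F) {B : ℚ}
    (hB : ∀ q, (B : WithTop ℚ) ≤ v (h.coeff q)) : ∃ x, IsLeast (termValues v h) x := by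
  by_cases h0 : h = 0
  · exact ⟨⊤, h0 ▸ isLeast_termValues_zero v⟩
  obtain ⟨q₀, hq₀⟩ := HahnSeries.support_nonempty_iff.2 h0
  -- Discreteness enters here: the part of `cℤ` bounded below is well ordered, and so is its sum
  -- with the support of `h`.
  let S : Set ℚ := (fun n : ℤ => (n * c : ℚ)) '' Set.Ici ⌊B / c⌋
  have hS : S.IsPWO := by
    refine Set.IsPWO.image_of_monotone (BddBelow.isWF bddBelow_Ici).isPWO fun a b hab => ?_
    exact mul_le_mul_of_nonneg_right (by exact_mod_cast hab) hc.le
  have hval : ∀ q ∈ h.support, ∃ y ∈ S, v (h.coeff q) = (y : WithTop ℚ) := fun q hq => by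
    obtain ⟨n, hn⟩ := hv _ hq
    refine ⟨n * c, ⟨n, ?_, rfl⟩, hn⟩
    have h1 := hB q
    rw [hn, WithTop.coe_le_coe] at h1
    have h2 : B / c ≤ n := by rwa [div_le_iff₀ hc]
    exact Int.cast_le.1 ((Int.floor_le _).trans h2)
  let T : Set ℚ := {x | ∃ q ∈ h.support, v (h.coeff q) + (q : WithTop ℚ) = (x : WithTop ℚ)}
  have hT : T.IsWF := by
    refine Set.IsWF.mono (hS.add h.isPWO_support).isWF ?_
    rintro x ⟨q, hq, hx⟩
    obtain ⟨y, hy, hvy⟩ := hval q hq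
    rw [hvy, ← WithTop.coe_add, WithTop.coe_inj] at hx
    exact ⟨y, hy, q, hq, hx⟩
  have hTne : T.Nonempty := by
    obtain ⟨y, -, hvy⟩ := hval q₀ hq₀
    exact ⟨y + q₀, q₀, hq₀, by rw [hvy, WithTop.coe_add]⟩
  obtain ⟨q, hq, hx⟩ := hT.min_mem hTne
  refine ⟨(hT.min hTne : ℚ), ⟨q, hx⟩, ?_⟩
  rintro _ ⟨r, rfl⟩
  by_cases hr : h.coeff r = 0
  · simp [hr]
  · obtain ⟨y, -, hvy⟩ := hval r hr
    dsimp only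
    rw [hvy, ← WithTop.coe_add, WithTop.coe_le_coe]
    exact hT.min_le hTne ⟨r, hr, by rw [hvy, WithTop.coe_add]⟩

variable {v}

theorem le_of_isLeast_termValues_add {f g : HahnSeries ℚ F} {x y z : WithTop ℚ}
    (hf : IsLeast (termValues v f) x) (hg : IsLeast (termValues v g) y)
    (hfg : IsLeast (termValues v (f + g)) z) : min x y ≤ z := by
  obtain ⟨q, rfl⟩ := hfg.1
  have h1 : min (v (f.coeff q)) (v (g.coeff q)) ≤ v ((f + g).coeff q) := v.map_add _ _
  refine le_trans ?_ (add_le_add_left h1 (q : WithTop ℚ))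
  rw [min_add]
  exact min_le_min (hf.2 ⟨q, rfl⟩) (hg.2 ⟨q, rfl⟩)

/-- The smallest exponent at which the least term value is attained. -/
theorem exists_first_exponent {f : HahnSeries ℚ F} {x : ℚ}
    (hf : IsLeast (termValues v f) (x : WithTop ℚ)) :
    ∃ i ∈ f.support, v (f.coeff i) = ((x - i : ℚ) : WithTop ℚ) ∧
      ∀ q < i, ((x - q : ℚ) : WithTop ℚ) < v (f.coeff q) := by
  -- The exponents that attain the least term value lie in the well-ordered support, so there is a
  -- first one.
  let T : Set ℚ := {q | v (f.coeff q) = ((x - q : ℚ) : WithTop ℚ)}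
  have hle : ∀ q, ((x - q : ℚ) : WithTop ℚ) ≤ v (f.coeff q) := fun q =>
    (le_add_coe_iff _ _ _).1 (hf.2 ⟨q, rfl⟩)
  have hTs : T ⊆ f.support := fun q hq h0 => by
    have hq' : v (f.coeff q) = ((x - q : ℚ) : WithTop ℚ) := hq
    rw [h0, v.map_zero] at hq'
    exact WithTop.top_ne_coe hq'
  have hT : T.IsWF := f.isWF_support.mono hTs
  have hTne : T.Nonempty := by
    obtain ⟨q, hq⟩ := hf.1
    refine ⟨q, le_antisymm ?_ (hle q)⟩
    dsimp only at hq
    cases ha : v (f.coeff q) with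
    | top => simp [ha] at hq
    | coe a =>
      rw [ha, ← WithTop.coe_add, WithTop.coe_inj] at hq
      rw [WithTop.coe_le_coe]
      linarith
  refine ⟨hT.min hTne, hTs (hT.min_mem hTne), hT.min_mem hTne, fun q hq => ?_⟩
  exact lt_of_le_of_ne (hle q) fun h => hT.not_lt_min hTne (show q ∈ T from h.symm) hq

/-- Gauss's lemma. If `i` and `j` are the first exponents at which `f` and `g` attain their least
term values, then in the coefficient of `f * g` at `i + j` every other product has a factor with
exponent before `i` or before `j`, hence strictly larger value. The product at `(i, j)` thus
dominates, and no cancellation occurs. The opposite inequality holds term by term. -/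
theorem eq_add_of_isLeast_termValues_mul {f g : HahnSeries ℚ F} {x y z : WithTop ℚ}
    (hf : IsLeast (termValues v f) x) (hg : IsLeast (termValues v g) y)
    (hfg : IsLeast (termValues v (f * g)) z) : z = x + y := by
  cases x with
  | top =>
    rw [eq_zero_of_isLeast_termValues_top v hf, zero_mul] at hfg
    rw [top_add, hfg.unique (isLeast_termValues_zero v)]
  | coe x =>
  cases y with
  | top =>
    rw [eq_zero_of_isLeast_termValues_top v hg, mul_zero] at hfg
    rw [add_top, hfg.unique (isLeast_termValues_zero v)]
  | coe y =>
  have hfle : ∀ q, ((x - q : ℚ) : WithTop ℚ) ≤ v (f.coeff q) := fun q =>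
    (le_add_coe_iff _ _ _).1 (hf.2 ⟨q, rfl⟩)
  have hgle : ∀ q, ((y - q : ℚ) : WithTop ℚ) ≤ v (g.coeff q) := fun q =>
    (le_add_coe_iff _ _ _).1 (hg.2 ⟨q, rfl⟩)
  refine le_antisymm ?_ ?_
  · obtain ⟨i, hi, hvi, hi'⟩ := exists_first_exponent hf
    obtain ⟨j, hj, hvj, hj'⟩ := exists_first_exponent hg
    have hcoeff : v ((f * g).coeff (i + j)) = ((x - i + (y - j) : ℚ) : WithTop ℚ) := by
      have hmem : (i, j) ∈ Finset.antidiagonal f.isPWO_support g.isPWO_support (i + j) := by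
        rw [Finset.mem_antidiagonal]
        exact ⟨hi, hj, rfl⟩
      rw [HahnSeries.coeff_mul, ← Finset.add_sum_erase _ _ hmem, v.map_add_eq_of_lt_left] <;>
      rw [v.map_mul, hvi, hvj, ← WithTop.coe_add]
      refine v.map_lt_sum WithTop.coe_ne_top fun p hp => ?_
      obtain ⟨hne, hp⟩ := Finset.mem_erase.1 hp
      obtain ⟨-, -, hsum⟩ := Finset.mem_antidiagonal.1 hp
      have heq : x - i + (y - j) = (x - p.1) + (y - p.2) := by linarith
      rw [v.map_mul, heq, WithTop.coe_add]
      rcases lt_trichotomy p.1 i with h | h | h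
      · exact WithTop.add_lt_add_of_lt_of_le WithTop.coe_ne_top (hi' _ h) (hgle _)
      · exact absurd (Prod.ext h (by linarith)) hne
      · exact WithTop.add_lt_add_of_le_of_lt WithTop.coe_ne_top (hfle _) (hj' _ (by linarith))
    refine (hfg.2 ⟨i + j, rfl⟩).trans ?_
    dsimp only
    rw [hcoeff, ← WithTop.coe_add, ← WithTop.coe_add, WithTop.coe_le_coe]
    linarith
  · obtain ⟨q, rfl⟩ := hfg.1
    rw [← WithTop.coe_add, le_add_coe_iff, HahnSeries.coeff_mul]
    refine v.map_le_sum fun p hp => ?_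
    obtain ⟨-, -, hsum⟩ := Finset.mem_antidiagonal.1 hp
    have heq : x + y - q = (x - p.1) + (y - p.2) := by linarith
    rw [v.map_mul, heq, WithTop.coe_add]
    exact add_le_add (hfle _) (hgle _)

variable (v)

/-- The Gauss valuation on a ring of series with bounded below coefficients. -/
noncomputable def gaussAddValuation {A : Type*} [CommRing A] (Φ : A →+* HahnSeries ℚ F)
    (hΦ : ∀ a, ∃ x, IsLeast (termValues v (Φ a)) x) : AddValuation A (WithTop ℚ) :=
  AddValuation.of (fun a => (hΦ a).choose)
    ((hΦ 0).choose_spec.unique (by rw [map_zero]; exact isLeast_termValues_zero v))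
    ((hΦ 1).choose_spec.unique (by
      have h := isLeast_termValues_C v 1
      rwa [v.map_one, map_one, ← map_one Φ] at h))
    (fun a b => le_of_isLeast_termValues_add (hΦ a).choose_spec (hΦ b).choose_spec
      (by rw [← map_add]; exact (hΦ (a + b)).choose_spec))
    (fun a b => eq_add_of_isLeast_termValues_mul (hΦ a).choose_spec (hΦ b).choose_spec
      (by rw [← map_mul]; exact (hΦ (a * b)).choose_spec))

theorem gaussAddValuation_eq {A : Type*} [CommRing A] (Φ : A →+* HahnSeries ℚ F)
    (hΦ : ∀ a, ∃ x, IsLeast (termValues v (Φ a)) x) {a : A} {x : WithTop ℚ}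
    (hx : IsLeast (termValues v (Φ a)) x) : gaussAddValuation v Φ hΦ a = x :=
  (hΦ a).choose_spec.unique hx

end

/-! ### Extension of valuations of the function field to Puiseux series -/

section

open TensorProduct

/-- Two ring homomorphisms that agree on the base ring define one on the tensor product. -/
noncomputable def tensorProductLift {k R P G : Type*} [CommRing k] [CommRing R] [CommRing P]
    [CommRing G] [Algebra k R] [Algebra k P] (f : R →+* G) (g : P →+* G)
    (h : ∀ c, f (algebraMap k R c) = g (algebraMap k P c)) : R ⊗[k] P →+* G :=
  letI : Algebra k G := (f.comp (algebraMap k R)).toAlgebra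
  (Algebra.TensorProduct.lift (AlgHom.mk f fun _ => rfl) (AlgHom.mk g fun c => (h c).symm)
    (fun _ _ => Commute.all _ _) : R ⊗[k] P →ₐ[k] G).toRingHom

theorem tensorProductLift_tmul {k R P G : Type*} [CommRing k] [CommRing R] [CommRing P]
    [CommRing G] [Algebra k R] [Algebra k P] (f : R →+* G) (g : P →+* G)
    (h : ∀ c, f (algebraMap k R c) = g (algebraMap k P c)) (r : R) (p : P) :
    tensorProductLift f g h (r ⊗ₜ[k] p) = f r * g p :=
  rfl

/-- Extension of coefficients of a Puiseux series. -/
def puiseuxMap (k : Type u) [Field k] (F : Type u) [Field F] [Algebra k F] :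
    Puiseux k →+* HahnSeries ℚ F where
  toFun a := (a : HahnSeries ℚ k).map (algebraMap k F)
  map_zero' := by ext; simp
  map_one' := by
    rw [OneMemClass.coe_one, ← HahnSeries.C_one, HahnSeries.map_C, map_one, HahnSeries.C_one]
  map_add' a b := by ext; simp
  map_mul' a b := HahnSeries.map_mul (algebraMap k F : k →ₙ+* F)

theorem puiseuxMap_coeff (k : Type u) [Field k] (F : Type u) [Field F] [Algebra k F]
    (a : Puiseux k) (q : ℚ) :
    (puiseuxMap k F a).coeff q = algebraMap k F ((a : HahnSeries ℚ k).coeff q) := rfl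

theorem puiseuxMap_algebraMap (k : Type u) [Field k] (F : Type u) [Field F] [Algebra k F]
    (c : k) : puiseuxMap k F (algebraMap k (Puiseux k) c) = HahnSeries.C (algebraMap k F c) :=
  HahnSeries.map_C c (algebraMap k F)

variable {k : Type u} [Field k] {R : Type u} [CommRing R] [Algebra k R]
  (F : Type u) [Field F] [Algebra R F] [Algebra k F] [IsScalarTower k R F]

variable (k R) in
/-- The map `R ⊗ₖ K → F((ε^ℚ))`. -/
noncomputable def tensorPuiseuxMap : R ⊗[k] Puiseux k →+* HahnSeries ℚ F :=
  tensorProductLift ((HahnSeries.C : F →+* HahnSeries ℚ F).comp (algebraMap R F)) (puiseuxMap k F)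
    fun c => by
      rw [puiseuxMap_algebraMap, RingHom.comp_apply, ← IsScalarTower.algebraMap_apply]

theorem tensorPuiseuxMap_tmul (r : R) (a : Puiseux k) :
    tensorPuiseuxMap k R F (r ⊗ₜ a) = HahnSeries.C (algebraMap R F r) * puiseuxMap k F a :=
  tensorProductLift_tmul _ _ _ r a

variable {F} (v : AddValuation F (WithTop ℚ))

/-- The coefficients of the image of `r ⊗ a` are multiples of `r` by constants, hence have value
`v(r)` or `⊤`; an element of the tensor product is a finite sum of such terms. -/
theorem exists_le_coeff_tensorPuiseuxMap (hv : ∀ a : k, a ≠ 0 → v (algebraMap k F a) = 0)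
    (t : R ⊗[k] Puiseux k) :
    ∃ B : ℚ, ∀ q, (B : WithTop ℚ) ≤ v ((tensorPuiseuxMap k R F t).coeff q) := by
  induction t using TensorProduct.induction_on with
  | zero => exact ⟨0, fun q => by simp⟩
  | tmul r a =>
    obtain ⟨B, hB⟩ : ∃ B : ℚ, (B : WithTop ℚ) ≤ v (algebraMap R F r) := by
      cases v (algebraMap R F r) with
      | top => exact ⟨0, le_top⟩
      | coe x => exact ⟨x, le_rfl⟩
    refine ⟨B, fun q => ?_⟩
    rw [tensorPuiseuxMap_tmul, HahnSeries.C_mul_eq_smul, HahnSeries.coeff_smul, smul_eq_mul,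
      v.map_mul, puiseuxMap_coeff]
    by_cases h : (a : HahnSeries ℚ k).coeff q = 0
    · simp [h]
    · rwa [hv _ h, add_zero]
  | add x y hx hy =>
    obtain ⟨B, hB⟩ := hx
    obtain ⟨B', hB'⟩ := hy
    refine ⟨min B B', fun q => ?_⟩
    rw [map_add, HahnSeries.coeff_add]
    refine le_trans ?_ (v.map_add _ _)
    rw [WithTop.coe_min]
    exact min_le_min (hB q) (hB' q)

/-- Nonzero constants have value zero, so the term values are the exponents in the support of `a`,
together with `⊤`. -/
theorem isLeast_termValues_puiseuxMap (hv : ∀ a : k, a ≠ 0 → v (algebraMap k F a) = 0)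
    (a : Puiseux k) :
    IsLeast (termValues v (puiseuxMap k F a)) (puiseuxOrd k a) := by
  by_cases h0 : a = 0
  · rw [h0, map_zero, AddValuation.map_zero]
    exact isLeast_termValues_zero v
  have h0' : (a : HahnSeries ℚ k) ≠ 0 := fun h => h0 (Subtype.ext h)
  have hord : puiseuxOrd k a = ((a : HahnSeries ℚ k).order : WithTop ℚ) :=
    HahnSeries.addVal_apply_of_ne h0'
  rw [hord]
  refine ⟨⟨(a : HahnSeries ℚ k).order, ?_⟩, ?_⟩
  · dsimp only
    rw [puiseuxMap_coeff, hv _ (HahnSeries.coeff_order_eq_zero.not.2 h0'), zero_add]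
  · rintro _ ⟨q, rfl⟩
    dsimp only
    rw [puiseuxMap_coeff]
    by_cases h : (a : HahnSeries ℚ k).coeff q = 0
    · simp [h]
    · rw [hv _ h, zero_add, WithTop.coe_le_coe]
      exact HahnSeries.order_le_of_coeff_ne_zero h

/-- A discrete or trivial valuation of `F`, trivial on `k`, and `ord` have a common extension to
`R ⊗ₖ K`. -/
theorem exists_addValuation_tensor_puiseux (hv : ∀ a : k, a ≠ 0 → v (algebraMap k F a) = 0)
    {c : ℚ} (hc : 0 < c) (hvc : ∀ x : F, x ≠ 0 → ∃ n : ℤ, v x = ((n * c : ℚ) : WithTop ℚ)) :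
    ∃ val : AddValuation (R ⊗[k] Puiseux k) (WithTop ℚ),
      (∀ a : Puiseux k, val (Algebra.TensorProduct.includeRight a) = puiseuxOrd k a) ∧
      ∀ r : R, val (Algebra.TensorProduct.includeLeft (S := k) r) = v (algebraMap R F r) := by
  have hΦ : ∀ t, ∃ x, IsLeast (termValues v (tensorPuiseuxMap k R F t)) x := fun t => by
    obtain ⟨B, hB⟩ := exists_le_coeff_tensorPuiseuxMap v hv t
    exact exists_isLeast_termValues v hc hvc _ hB
  refine ⟨gaussAddValuation v (tensorPuiseuxMap k R F) hΦ, fun a => ?_, fun r => ?_⟩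
  · refine gaussAddValuation_eq v _ hΦ ?_
    rw [Algebra.TensorProduct.includeRight_apply, tensorPuiseuxMap_tmul, map_one, map_one, one_mul]
    exact isLeast_termValues_puiseuxMap v hv a
  · refine gaussAddValuation_eq v _ hΦ ?_
    rw [Algebra.TensorProduct.includeLeft_apply, tensorPuiseuxMap_tmul, map_one, mul_one]
    exact isLeast_termValues_C v _

end

/-! ### Comparison of tropical points with classes of valuations of `k(X)`. -/

/-- The characters span the coordinate ring. -/
theorem span_range_charOn {k : Type u} [Field k] {M : Type u} [AddCommGroup M]
    (I : Ideal (AddMonoidAlgebra k M)) : Submodule.span k (Set.range (charOn I)) = ⊤ := by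
  rw [eq_top_iff]
  rintro r -
  obtain ⟨f, rfl⟩ := Ideal.Quotient.mk_surjective r
  induction f using AddMonoidAlgebra.induction_on with
  | of m => exact Submodule.subset_span ⟨m, rfl⟩
  | add f g hf hg =>
    rw [map_add]
    exact add_mem hf hg
  | smul c f hf => exact Submodule.smul_mem _ c hf

section

variable {k : Type u} [Field k] {M : Type u} [AddCommGroup M]
  (I : Ideal (AddMonoidAlgebra k M)) [I.IsPrime]

/-- The class of a discrete or trivial valuation of the function field lies in the tropical
variety. -/
theorem bracket_charFunctionField_mem_tropicalVariety
    (v : AddValuation (FractionRing (CoordRing I)) (WithTop ℚ))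
    (hv : ∀ a : k, a ≠ 0 → v (algebraMap k (FractionRing (CoordRing I)) a) = 0)
    {c : ℚ} (hc : 0 < c)
    (hvc : ∀ x : FractionRing (CoordRing I), x ≠ 0 →
      ∃ n : ℤ, v x = ((n * c : ℚ) : WithTop ℚ)) :
    bracket (charFunctionField I) v ∈ tropicalVariety I := by
  obtain ⟨val, hval, hval'⟩ :=
    exists_addValuation_tensor_puiseux (k := k) (R := CoordRing I) v hv hc hvc
  refine ⟨val, ⟨isRingValuation_of_commRing val, hval⟩, ?_⟩
  ext m
  rw [← WithTop.coe_inj, coe_bracket, coe_bracket]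
  exact hval' _

theorem image_discreteValuations_subset_tropicalVariety :
    bracket (charFunctionField I) '' discreteValuations k (FractionRing (CoordRing I)) ⊆
      tropicalVariety I := by
  rintro _ ⟨v, ⟨hv, c, hc, hvc⟩, rfl⟩
  refine bracket_charFunctionField_mem_tropicalVariety I v hv hc fun x hx => ?_
  obtain ⟨q, hq⟩ := WithTop.ne_top_iff_exists.1 (v.top_iff.not.2 hx)
  obtain ⟨n, hn⟩ := (hvc q).1 ⟨x, hq.symm⟩
  exact ⟨n, by rw [← hq, hn]⟩

theorem image_trivialValuation_subset_tropicalVariety :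
    bracket (charFunctionField I) '' trivialValuation (FractionRing (CoordRing I)) ⊆
      tropicalVariety I := by
  rintro _ ⟨v, hv, rfl⟩
  -- The only finite value is `0`, which lies in any lattice; `c = 1` is an arbitrary choice.
  refine bracket_charFunctionField_mem_tropicalVariety I v (fun a ha => hv _ ?_) one_pos
    fun x hx => ⟨0, ?_⟩
  · rwa [Ne, map_eq_zero]
  · rw [hv x hx]
    simp

/-- The trivial valuation defines `0`. -/
theorem zero_mem_image_trivialValuation :
    (0 : M →+ ℚ) ∈
      bracket (charFunctionField I) '' trivialValuation (FractionRing (CoordRing I)) := by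
  classical
  let v : AddValuation (FractionRing (CoordRing I)) (WithTop ℚ) :=
    AddValuation.of (fun x => if x = 0 then ⊤ else 0) (if_pos rfl) (if_neg one_ne_zero)
      (fun x y => by
        by_cases hx : x = 0
        · rw [hx, if_pos rfl, zero_add]
          exact min_le_right _ _
        · rw [if_neg hx]
          refine (min_le_left _ _).trans ?_
          split_ifs <;> simp)
      (fun x y => by
        by_cases hx : x = 0
        · simp [hx]
        by_cases hy : y = 0 <;> simp [hx, hy])
  have hv : ∀ x, x ≠ 0 → v x = 0 := fun x hx => if_neg hx
  refine ⟨v, hv, ?_⟩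
  ext m
  rw [← WithTop.coe_inj, coe_bracket, hv _ ((Group.isUnit _).map (charFunctionField I)).ne_zero]
  rfl

variable [PerfectField k] [Module.Finite ℤ M]

/-- Only the restriction of `val` to `k[X]` matters. The condition on `K` is used only through
constants, where `ord` is nonnegative. -/
theorem exists_mem_divisorialValuations_of_mem_tropicalVariety {w : M →+ ℚ}
    (hw : w ∈ tropicalVariety I) (hw0 : w ≠ 0) :
    w ∈ bracket (charFunctionField I) ''
      divisorialValuations k (FractionRing (CoordRing I)) := by
  obtain ⟨val, ⟨-, hval⟩, rfl⟩ := hw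
  let val' : AddValuation (CoordRing I) (WithTop ℚ) :=
    val.comap (Algebra.TensorProduct.includeLeft :
      CoordRing I →ₐ[k] PuiseuxCoordRing I).toRingHom
  have hbr : bracket (charPuiseux I) val = bracket (charOn I) val' := rfl
  rw [hbr] at hw0 ⊢
  refine exists_mem_divisorialValuations_bracket_eq (charOn I) _ (span_range_charOn I) val'
    (fun a => ?_) hw0
  have h1 : val' (algebraMap k (CoordRing I) a) = puiseuxOrd k (algebraMap k (Puiseux k) a) := by
    rw [← hval]
    change val ((Algebra.TensorProduct.includeLeft : CoordRing I →ₐ[k] PuiseuxCoordRing I)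
      (algebraMap k (CoordRing I) a)) = _
    rw [AlgHom.commutes, AlgHom.commutes]
  rw [h1]
  by_cases ha : a = 0
  · rw [ha, map_zero, AddValuation.map_zero]
    exact le_top
  · refine le_of_eq ?_
    change 0 = HahnSeries.addVal ℚ k (HahnSeries.C a)
    rw [HahnSeries.addVal_apply, HahnSeries.C_apply, HahnSeries.orderTop_single ha]
    rfl

end

theorem theorem2p3 {k : Type u} [Field k] [IsAlgClosed k]
    {M : Type u} [AddCommGroup M] [Module.Free ℤ M] [Module.Finite ℤ M]
    (I : Ideal (AddMonoidAlgebra k M)) [I.IsPrime] :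
    (0 < ringKrullDim (CoordRing I) →
      tropicalVariety I =
          bracket (charFunctionField I) ''
            divisorialValuations k
              (FractionRing (CoordRing I)) ∧
      tropicalVariety I =
          bracket (charFunctionField I) ''
            discreteValuations k
              (FractionRing (CoordRing I))) ∧
    tropicalVariety I =
        bracket (charFunctionField I) ''
          (divisorialValuations k
              (FractionRing (CoordRing I)) ∪
            trivialValuation
              (FractionRing (CoordRing I))) ∧
    tropicalVariety I =
        bracket (charFunctionField I) ''
          (discreteValuations k
              (FractionRing (CoordRing I)) ∪
            trivialValuation
              (FractionRing (CoordRing I))) := by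
  have hWD := Set.image_mono (f := bracket (charFunctionField I))
    (divisorialValuations_subset_discreteValuations k (FractionRing (CoordRing I)))
  have hD := image_discreteValuations_subset_tropicalVariety I
  have h0 := image_trivialValuation_subset_tropicalVariety I
  have hT := fun w => exists_mem_divisorialValuations_of_mem_tropicalVariety I (w := w)
  rw [Set.image_union, Set.image_union]
  refine ⟨fun hdim => ?_, ?_, ?_⟩
  · have hTW : tropicalVariety I ⊆ bracket (charFunctionField I) ''
        divisorialValuations k (FractionRing (CoordRing I)) := fun w hw => by
      -- In positive dimension `k[X]` is not a field, so class `0` is divisorial as well.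
      by_cases hw0 : w = 0
      · rw [hw0]
        have hfg : AddMonoid.FG M := AddGroup.fg_iff_addMonoid_fg.1
          (Module.Finite.iff_addGroup_fg.1 inferInstance)
        exact exists_mem_divisorialValuations_bracket_eq_zero (charOn I) _ fun h =>
          hdim.ne' (ringKrullDim_eq_zero_of_isField h)
      · exact hT w hw hw0
    exact ⟨hTW.antisymm (hWD.trans hD), (hTW.trans hWD).antisymm hD⟩
  · refine Set.Subset.antisymm (fun w hw => ?_) (Set.union_subset (hWD.trans hD) h0)
    by_cases hw0 : w = 0
    · exact .inr (hw0 ▸ zero_mem_image_trivialValuation I)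
    · exact .inl (hT w hw hw0)
  · refine Set.Subset.antisymm (fun w hw => ?_) (Set.union_subset hD h0)
    by_cases hw0 : w = 0
    · exact .inr (hw0 ▸ zero_mem_image_trivialValuation I)
    · exact .inl (hWD (hT w hw hw0))
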